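/- Let $(\Sigma,\langle\,,\rangle)$ be a non-empty (Hausdorff, smooth, finite-dimensional) Riemannian manifold without boundary, with Levi-Civita connection $\nabla$, and for $u\in C^2(\Sigma)$ let $\nabla u$ be its gradient and $\operatorname{hess}u(X)=\nabla_X\nabla u$ its Hessian operator. Let $P$ assign to each $p\in\Sigma$ a symmetric positive semi-definite endomorphism of $T_p\Sigma$, with $\sup_\Sigma \operatorname{Tr}P<+\infty$, and let $L$ be the semi-elliptic operator $Lu=\operatorname{Tr}(P\circ\operatorname{hess}u)$. Let $G$ be a smooth real function on $[0,+\infty)$ such that (i) $G(0)>0$; (ii) $G'(t)\ge 0$ on $[0,+\infty)$; (iii) $\int_0^{+\infty}G(t)^{-1/2}\,dt=+\infty$; (iv) $\limsup_{t\to+\infty}\dfrac{t\,G(t^{1/2})}{G(t)}<+\infty$. Assume that there is a non-negative function $\gamma\in C^2(\Sigma)$ such that - $\gamma(p)\to+\infty$ as $p\to\infty$, that is, for every $c$ one has $\gamma>c$ off a compact set; - there is $A>0$ such that $|\nabla\gamma|\le A\,\gamma^{1/2}$ off a compact set; - there is $B>0$ such that $L\gamma\le B\,\gamma^{1/2}\,G(\gamma^{1/2})^{1/2}$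 off a compact set. Then for every $u\in C^2(\Sigma)$ with $u^*=\sup_\Sigma u<+\infty$ there is a sequence $(p_j)_{j\ge1}$ in $\Sigma$ such that, for every $j\ge 1$, $$u(p_j)>u^*-\frac1j,\qquad |\nabla u(p_j)|<\frac1j,\qquad Lu(p_j)<\frac1j .$$ -/

import Mathlib

open Bundle Set Filter Topology MeasureTheory Manifold NormedSpace
open scoped ContDiff

noncomputable section

namespace TraceOperator

variable {E : Type*} [NormedAddCommGroup E] [NormedSpace ℝ E] [FiniteDimensional ℝ E]
  {H : Type*} [TopologicalSpace H] (I : ModelWithCorners ℝ E H)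
  {M : Type*} [TopologicalSpace M] [ChartedSpace H M] [IsManifold I ∞ M]

instance finiteDimensional_tangentSpace (p : M) : FiniteDimensional ℝ (TangentSpace I p) :=
  inferInstanceAs (FiniteDimensional ℝ E)

variable [RiemannianBundle (fun x : M ↦ TangentSpace I x)]

instance completeSpace_tangentSpace (p : M) : CompleteSpace (TangentSpace I p) :=
  FiniteDimensional.complete ℝ _

/-- The gradient `∇u` of `u`: the vector field with `⟪∇u, X⟫ = du(X)` for every `X`. -/
def grad (u : M → ℝ) (p : M) : TangentSpace I p :=
  (InnerProductSpace.toDual ℝ (TangentSpace I p)).symm (mvfderiv I u p)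

/-- The vector field `σ` near `p`, written in the coordinates of the preferred chart at `p`. -/
def fieldInChart (σ : Π x : M, TangentSpace I x) (p q : M) : E :=
  (trivializationAt E (TangentSpace I) p ⟨q, σ q⟩).2

/-- The Riemannian metric near `p`, written in the coordinates of the preferred chart at `p`
(the matrix `(g_ij)`, as a function of the point `q`). -/
def metricInChart (p q : M) : E →L[ℝ] E →L[ℝ] ℝ :=
  (innerSL ℝ (E := TangentSpace I q)).bilinearComp
    ((trivializationAt E (TangentSpace I) p).symmL ℝ q)
    ((trivializationAt E (TangentSpace I) p).symmL ℝ q)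

/-- First derivatives of the metric at `p` in the preferred chart at `p`: with `X`, `Y`, `Z`
expressed in the coordinate frame, `metricDeriv I p X Y Z = X^i Y^j Z^k ∂_i g_jk`. -/
def metricDeriv (p : M) (X Y Z : TangentSpace I p) : ℝ :=
  mvfderiv I (metricInChart I p) p X
    ((trivializationAt E (TangentSpace I) p).continuousLinearMapAt ℝ p Y)
    ((trivializationAt E (TangentSpace I) p).continuousLinearMapAt ℝ p Z)

set_option synthInstance.maxHeartbeats 200000 in
/-- The Christoffel symbols of the first kind at `p` in the preferred chart at `p`:
`Z ↦ X^i Y^j Z^k (∂_i g_jk + ∂_j g_ik - ∂_k g_ij) / 2`. -/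
def christoffelForm (p : M) (X Y : TangentSpace I p) : TangentSpace I p →ₗ[ℝ] ℝ where
  toFun Z := (metricDeriv I p X Y Z + metricDeriv I p Y X Z - metricDeriv I p Z X Y) / 2
  map_add' Z Z' := by simp only [metricDeriv, map_add, add_apply]; ring
  map_smul' c Z := by
    simp only [metricDeriv, map_smul, smul_apply, smul_eq_mul, RingHom.id_apply]; ring

/-- The Christoffel symbols of the second kind at `p` in the preferred chart at `p`:
`X^i Y^j Γ_ij^k ∂_k`. -/
def christoffel (p : M) (X Y : TangentSpace I p) : TangentSpace I p :=
  (InnerProductSpace.toDual ℝ (TangentSpace I p)).symm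
    (LinearMap.toContinuousLinearMap (christoffelForm I p X Y))

set_option synthInstance.maxHeartbeats 200000 in
/-- The covariant derivative `X ↦ ∇_X σ` at `p` of a vector field `σ` for the Levi-Civita
connection: `(∇_X σ)^k = X^i ∂_i σ^k + Γ_ij^k X^i σ^j`. -/
def covDeriv (σ : Π x : M, TangentSpace I x) (p : M) :
    TangentSpace I p →ₗ[ℝ] TangentSpace I p where
  toFun X := (trivializationAt E (TangentSpace I) p).symmL ℝ p
    (mvfderiv I (fieldInChart I σ p) p X) + christoffel I p X (σ p)
  map_add' X Y := by
    have h : christoffelForm I p (X + Y) (σ p) =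
        christoffelForm I p X (σ p) + christoffelForm I p Y (σ p) := by
      ext Z
      simp only [christoffelForm, metricDeriv, map_add, add_apply, LinearMap.coe_mk,
        AddHom.coe_mk, LinearMap.add_apply]
      ring
    simp only [christoffel, h, map_add]
    abel
  map_smul' c X := by
    have h : christoffelForm I p (c • X) (σ p) = c • christoffelForm I p X (σ p) := by
      ext Z
      simp only [christoffelForm, metricDeriv, map_smul, smul_apply, LinearMap.coe_mk,
        AddHom.coe_mk, LinearMap.smul_apply, smul_eq_mul]
      ring
    simp [christoffel, h]

/-- The Hessian operator `hess u (X) = ∇_X ∇u`. -/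
def hess (u : M → ℝ) (p : M) : TangentSpace I p →ₗ[ℝ] TangentSpace I p :=
  covDeriv I (grad I u) p

/-- The operator `L = Tr (P ∘ hess)`. -/
def traceOp (P : Π p : M, TangentSpace I p →ₗ[ℝ] TangentSpace I p) (u : M → ℝ) (p : M) : ℝ :=
  LinearMap.trace ℝ (TangentSpace I p) (P p ∘ₗ hess I u p)

end TraceOperator

end

/-!
The function `G` is monotone and positive on `[0, ∞)`, so `f = 1 / √G` is antitone and positive
there, and `ψ = ∫₀^γ f` is a concave function of `γ`. It is a continuous exhaustion function because
`f` is not integrable. The bound on the upper limit says `t G(√t) ≤ c G(t)` for large `t`; with the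
assumptions on `γ` it gives, off a compact set `K`,
`f(γ) |∇γ| ≤ A √(γ / G(γ)) ≤ A √(c / G(0))` and `f(γ) Lγ ≤ B √(γ G(√γ) / G(γ)) ≤ B √c`.

If `u` attains its supremum, a maximum point serves for every `j`. Otherwise, for small `ε > 0` the
function `u - ε ψ` attains its maximum at a point `p` with `u(p)` close to `sup u`
(`exists_perturbed_max`), and `p ∉ K` because `sup u` exceeds the maximum of `u` on `K`. Since `ψ` is
a concave function of `γ` (`AntitoneOn.integral_sub_integral_le`), the function `u - ε f(γ(p)) γ` has
a maximum at `p` too. The maximum principle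
(`TraceOperator.grad_eq_and_traceOp_le_of_isLocalMax_sub`) then gives
`∇u(p) = ε f(γ(p)) ∇γ(p)` and `Lu(p) ≤ ε f(γ(p)) Lγ(p)`, which are small with `ε`. The concavity
argument replaces the chain rule for `L(ψ)`, and since only points off `K` occur, no bound for
`hess γ` on `K` is needed.

The maximum principle rests on two facts about the Hessian. It is linear in `u` on `C²` functions
(`TraceOperator.hess_sub_smul`), because the gradient, being the inverse of the metric applied to the
differential, is differentiable. At a critical point its quadratic form is the second derivative of
the function in the chart (`TraceOperator.inner_hess_of_grad_eq_zero`), which is nonpositive at a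
maximum; pairing with a positive operator keeps the sign (`LinearMap.IsPositive.trace_comp_nonpos`).
-/

/-! ### Second-order conditions and traces -/

/-- If `g''(t) > 0`, then `t` would also be a local minimum, so `g` would be constant near `t`. -/
theorem IsLocalMax.deriv_deriv_nonpos {g : ℝ → ℝ} {t : ℝ} (h : IsLocalMax g t)
    (hc : ContinuousAt g t) : deriv (deriv g) t ≤ 0 := by
  by_contra! hpos
  have hmin := isLocalMin_of_deriv_deriv_pos hpos h.deriv_eq_zero hc
  have hconst : g =ᶠ[𝓝 t] fun _ ↦ g t := by
    filter_upwards [h, hmin] with s h1 h2 using le_antisymm h1 h2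
  rw [hconst.deriv.deriv_eq] at hpos
  simp at hpos

/-- The second-order necessary condition for a local maximum, by restriction to the line through
`x` in direction `e`. -/
theorem IsLocalMax.fderiv_fderiv_nonpos {E : Type*} [NormedAddCommGroup E] [NormedSpace ℝ E]
    {f : E → ℝ} {x : E} (h : IsLocalMax f x) (hf : ContDiffAt ℝ 2 f x) (e : E) :
    fderiv ℝ (fderiv ℝ f) x e e ≤ 0 := by
  let l : ℝ → E := fun t ↦ x + t • e
  have hl : ∀ t, HasDerivAt l e t := fun t ↦ by
    simpa [l] using ((hasDerivAt_id t).smul_const e).const_add x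
  have hl0 : l 0 = x := by simp [l]
  have hlc : Tendsto l (𝓝 0) (𝓝 x) := hl0 ▸ (hl 0).continuousAt
  have hmax : IsLocalMax (f ∘ l) 0 := by
    have := hlc.eventually h
    simpa [IsLocalMax, IsMaxFilter, hl0] using this
  have hd : deriv (f ∘ l) =ᶠ[𝓝 0] fun t ↦ fderiv ℝ f (l t) e := by
    have h1 : ∀ᶠ y in 𝓝 x, DifferentiableAt ℝ f y := by
      filter_upwards [hf.eventually (by simp)] with y hy using hy.differentiableAt (by simp)
    filter_upwards [hlc.eventually h1] with t ht
    exact (ht.hasFDerivAt.comp_hasDerivAt t (hl t)).deriv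
  have hd2 : HasDerivAt (fun t ↦ fderiv ℝ f (l t) e) (fderiv ℝ (fderiv ℝ f) x e e) 0 := by
    have h2 : DifferentiableAt ℝ (fderiv ℝ f) (l 0) := by
      rw [hl0]
      exact (hf.fderiv_right (m := 1) (by norm_num)).differentiableAt (by simp)
    have h3 := (h2.hasFDerivAt.comp_hasDerivAt 0 (hl 0)).clm_apply (hasDerivAt_const (0 : ℝ) e)
    simpa [hl0] using h3
  rw [← hd2.deriv, ← hd.deriv_eq]
  refine hmax.deriv_deriv_nonpos ?_
  exact ContinuousAt.comp (by rw [hl0]; exact hf.continuousAt) (hl 0).continuousAt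

/-- In an orthonormal eigenbasis `b` of `P`, with eigenvalues `λᵢ ≥ 0`, the trace of `P ∘ T` is
`∑ λᵢ ⟪bᵢ, T bᵢ⟫`; no symmetry of `T` is needed. -/
theorem LinearMap.IsPositive.trace_comp_nonpos {V : Type*} [NormedAddCommGroup V]
    [InnerProductSpace ℝ V] [FiniteDimensional ℝ V] {P T : V →ₗ[ℝ] V} (hP : P.IsPositive)
    (hT : ∀ x, inner ℝ (T x) x ≤ 0) : LinearMap.trace ℝ V (P ∘ₗ T) ≤ 0 := by
  let b := hP.isSymmetric.eigenvectorBasis rfl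
  rw [LinearMap.trace_eq_sum_inner _ b]
  refine Finset.sum_nonpos fun i _ ↦ ?_
  rw [LinearMap.comp_apply, ← hP.isSymmetric, hP.isSymmetric.apply_eigenvectorBasis]
  simp only [inner_smul_left]
  exact mul_nonpos_of_nonneg_of_nonpos (by simpa using hP.nonneg_eigenvalues rfl i)
    (by rw [real_inner_comm]; exact hT (b i))

namespace TraceOperator

variable {E : Type*} [NormedAddCommGroup E] [NormedSpace ℝ E]
  {M : Type*} [TopologicalSpace M] [ChartedSpace E M]

/-! ### Derivatives of functions and their chart representations -/

theorem mvfderiv_const_smul {F : Type*} [NormedAddCommGroup F] [NormedSpace ℝ F]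
    {h : M → F} {p : M} (hh : MDifferentiableAt 𝓘(ℝ, E) 𝓘(ℝ, F) h p) (a : ℝ) :
    mvfderiv 𝓘(ℝ, E) (a • h) p = a • mvfderiv 𝓘(ℝ, E) h p := by
  simp only [mvfderiv, const_smul_mfderiv hh]
  rfl

theorem mvfderiv_congr {F : Type*} [NormedAddCommGroup F] [NormedSpace ℝ F]
    {h k : M → F} {p : M} (hk : h =ᶠ[𝓝 p] k) :
    mvfderiv 𝓘(ℝ, E) h p = mvfderiv 𝓘(ℝ, E) k p := by
  simp only [mvfderiv, hk.mfderiv_eq]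
  rfl

theorem contDiffAt_comp_extChartAt_symm {u : M → ℝ} {p : M}
    (hu : ContMDiffAt 𝓘(ℝ, E) 𝓘(ℝ) 2 u p) :
    ContDiffAt ℝ 2 (u ∘ (extChartAt 𝓘(ℝ, E) p).symm) (extChartAt 𝓘(ℝ, E) p p) := by
  simpa [Function.comp_def, contDiffWithinAt_univ, chartAt_self_eq] using (contMDiffAt_iff.1 hu).2

theorem isLocalMax_comp_extChartAt_symm {u : M → ℝ} {p : M} (hu : IsLocalMax u p) :
    IsLocalMax (u ∘ (extChartAt 𝓘(ℝ, E) p).symm) (extChartAt 𝓘(ℝ, E) p p) := by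
  have h := (continuousAt_extChartAt_symm (I := 𝓘(ℝ, E)) p).tendsto
  have hinv := extChartAt_to_inv (I := 𝓘(ℝ, E)) p
  rw [hinv] at h
  filter_upwards [h.eventually hu] with x hx
  rw [Function.comp_apply, Function.comp_apply, hinv]
  exact hx

theorem hasFDerivAt_comp_extChartAt_symm {F : Type*} [NormedAddCommGroup F] [NormedSpace ℝ F]
    {h : M → F} {p : M} (hh : MDifferentiableAt 𝓘(ℝ, E) 𝓘(ℝ, F) h p) :
    HasFDerivAt (h ∘ (extChartAt 𝓘(ℝ, E) p).symm)
      (fderiv ℝ (h ∘ (extChartAt 𝓘(ℝ, E) p).symm) (extChartAt 𝓘(ℝ, E) p p))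
      (extChartAt 𝓘(ℝ, E) p p) := by
  have := ((mdifferentiableAt_iff _ _).1 hh).2
  exact DifferentiableAt.hasFDerivAt
    (by simpa [Function.comp_def, differentiableWithinAt_univ, chartAt_self_eq] using this)

/-! ### The gradient -/

section Gradient

variable [FiniteDimensional ℝ E] [RiemannianBundle (fun x : M ↦ TangentSpace 𝓘(ℝ, E) x)]

theorem inner_grad (u : M → ℝ) (p : M) (X : TangentSpace 𝓘(ℝ, E) p) :
    inner ℝ (grad 𝓘(ℝ, E) u p) X = mvfderiv 𝓘(ℝ, E) u p X :=
  InnerProductSpace.toDual_symm_apply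

theorem grad_sub_smul {u v : M → ℝ} {p : M} (hu : MDifferentiableAt 𝓘(ℝ, E) 𝓘(ℝ) u p)
    (hv : MDifferentiableAt 𝓘(ℝ, E) 𝓘(ℝ) v p) (a : ℝ) :
    grad 𝓘(ℝ, E) (u - a • v) p = grad 𝓘(ℝ, E) u p - a • grad 𝓘(ℝ, E) v p := by
  simp only [grad]
  rw [mvfderiv_sub hu (hv.const_smul a), mvfderiv_const_smul hv]
  simp

end Gradient

variable [IsManifold 𝓘(ℝ, E) ∞ M]

/-! ### The preferred chart and the coordinate frame -/

/-- The differential along the coordinate frame of the chart at `p` is the Fréchet derivative of the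
chart representation. -/
theorem mvfderiv_symmL {F : Type*} [NormedAddCommGroup F] [NormedSpace ℝ F]
    {h : M → F} {p q : M} (hq : q ∈ (chartAt E p).source)
    (hh : MDifferentiableAt 𝓘(ℝ, E) 𝓘(ℝ, F) h q) (e : E) :
    mvfderiv 𝓘(ℝ, E) h q ((trivializationAt E (TangentSpace 𝓘(ℝ, E)) p).symmL ℝ q e) =
      fderiv ℝ (h ∘ (extChartAt 𝓘(ℝ, E) p).symm) (extChartAt 𝓘(ℝ, E) p q) e := by
  have : IsManifold 𝓘(ℝ, E) 1 M := IsManifold.of_le (n := ∞) (by simp)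
  have hq' : q ∈ (extChartAt 𝓘(ℝ, E) p).source := by simpa using hq
  have hinv := (extChartAt 𝓘(ℝ, E) p).left_inv hq'
  have hs : MDifferentiableAt 𝓘(ℝ, E) 𝓘(ℝ, E) (extChartAt 𝓘(ℝ, E) p).symm
      (extChartAt 𝓘(ℝ, E) p q) := by
    have := mdifferentiableWithinAt_extChartAt_symm (I := 𝓘(ℝ, E))
      ((extChartAt 𝓘(ℝ, E) p).map_source hq')
    simpa [mdifferentiableWithinAt_univ] using this
  rw [TangentBundle.symmL_trivializationAt hq, ModelWithCorners.range_eq_univ, mfderivWithin_univ]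
  refine (mfderiv_comp_apply_of_eq _ hh hs hinv e).symm.trans ?_
  rw [mfderiv_eq_fderiv]
  rfl

theorem eventually_mdifferentiableAt {u : M → ℝ} {p : M} (hu : ContMDiffAt 𝓘(ℝ, E) 𝓘(ℝ) 2 u p) :
    ∀ᶠ q in 𝓝 p, MDifferentiableAt 𝓘(ℝ, E) 𝓘(ℝ) u q := by
  have : IsManifold 𝓘(ℝ, E) 2 M := IsManifold.of_le (n := ∞) (WithTop.coe_le_coe.2 le_top)
  filter_upwards [(contMDiffAt_iff_contMDiffAt_nhds (by simp)).1 hu] with q hq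
  exact hq.mdifferentiableAt (by simp)

theorem fieldInChart_eq (σ : Π x : M, TangentSpace 𝓘(ℝ, E) x) {p q : M}
    (hq : q ∈ (chartAt E p).source) :
    fieldInChart 𝓘(ℝ, E) σ p q =
      (trivializationAt E (TangentSpace 𝓘(ℝ, E)) p).continuousLinearMapAt ℝ q (σ q) := by
  have hq' : q ∈ (trivializationAt E (TangentSpace 𝓘(ℝ, E)) p).baseSet := by simpa using hq
  rw [Trivialization.continuousLinearMapAt_apply, Trivialization.linearMapAt_apply, if_pos hq']
  rfl

theorem exists_symmL_eq {p : M} (X : TangentSpace 𝓘(ℝ, E) p) :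
    ∃ e : E, (trivializationAt E (TangentSpace 𝓘(ℝ, E)) p).symmL ℝ p e = X :=
  ⟨_, Trivialization.symmL_continuousLinearMapAt _ (by simp) X⟩

theorem symmL_fieldInChart (σ : Π x : M, TangentSpace 𝓘(ℝ, E) x) {p q : M}
    (hq : q ∈ (chartAt E p).source) :
    (trivializationAt E (TangentSpace 𝓘(ℝ, E)) p).symmL ℝ q (fieldInChart 𝓘(ℝ, E) σ p q) = σ q := by
  rw [fieldInChart_eq σ hq]
  exact Trivialization.symmL_continuousLinearMapAt _ (by simpa using hq) _

/-! ### The metric and the Christoffel symbols in coordinates -/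

variable [RiemannianBundle (fun x : M ↦ TangentSpace 𝓘(ℝ, E) x)]

theorem metricInChart_apply (p q : M) (v w : E) :
    metricInChart 𝓘(ℝ, E) p q v w =
      inner ℝ ((trivializationAt E (TangentSpace 𝓘(ℝ, E)) p).symmL ℝ q v)
        ((trivializationAt E (TangentSpace 𝓘(ℝ, E)) p).symmL ℝ q w) := rfl

variable [FiniteDimensional ℝ E]

/-- In coordinates, the gradient is characterised by `g_ij ∇ʲu = ∂_i u`. -/
theorem metricInChart_fieldInChart_grad {u : M → ℝ} {p q : M}
    (hq : q ∈ (chartAt E p).source) (hu : MDifferentiableAt 𝓘(ℝ, E) 𝓘(ℝ) u q) :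
    metricInChart 𝓘(ℝ, E) p q (fieldInChart 𝓘(ℝ, E) (grad 𝓘(ℝ, E) u) p q) =
      fderiv ℝ (u ∘ (extChartAt 𝓘(ℝ, E) p).symm) (extChartAt 𝓘(ℝ, E) p q) := by
  ext e
  rw [metricInChart_apply, symmL_fieldInChart _ hq, inner_grad, mvfderiv_symmL hq hu]

/-- The matrix of the metric is injective by definiteness, hence invertible by dimension. -/
theorem isInvertible_metricInChart {p q : M} (hq : q ∈ (chartAt E p).source) :
    (metricInChart 𝓘(ℝ, E) p q).IsInvertible := by
  have hinj : Function.Injective (metricInChart 𝓘(ℝ, E) p q) := by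
    rw [injective_iff_map_eq_zero]
    intro v hv
    have h0 := congrArg (fun l : E →L[ℝ] ℝ ↦ l v) hv
    simp only [metricInChart_apply, zero_apply, inner_self_eq_zero] at h0
    have hq' : q ∈ (trivializationAt E (TangentSpace 𝓘(ℝ, E)) p).baseSet := by simpa using hq
    have h1 := (trivializationAt E (TangentSpace 𝓘(ℝ, E)) p).continuousLinearMapAt_symmL
      (R := ℝ) hq' v
    rw [h0, map_zero] at h1
    exact h1.symm
  have hdim : Module.finrank ℝ E = Module.finrank ℝ (E →L[ℝ] ℝ) := by
    rw [← (LinearMap.toContinuousLinearMap : (E →ₗ[ℝ] ℝ) ≃ₗ[ℝ] (E →L[ℝ] ℝ)).finrank_eq]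
    exact (Subspace.dual_finrank_eq (K := ℝ) (V := E)).symm
  exact ⟨(LinearMap.linearEquivOfInjective
    (metricInChart 𝓘(ℝ, E) p q : E →ₗ[ℝ] E →L[ℝ] ℝ) hinj hdim).toContinuousLinearEquiv, rfl⟩

set_option synthInstance.maxHeartbeats 200000 in
theorem christoffel_sub_smul (p : M) (X Y Z : TangentSpace 𝓘(ℝ, E) p) (a : ℝ) :
    christoffel 𝓘(ℝ, E) p X (Y - a • Z) =
      christoffel 𝓘(ℝ, E) p X Y - a • christoffel 𝓘(ℝ, E) p X Z := by
  have h : christoffelForm 𝓘(ℝ, E) p X (Y - a • Z) =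
      christoffelForm 𝓘(ℝ, E) p X Y - a • christoffelForm 𝓘(ℝ, E) p X Z := by
    ext W
    simp only [christoffelForm, metricDeriv, map_sub, map_smul, sub_apply, smul_apply, smul_eq_mul,
      LinearMap.coe_mk, AddHom.coe_mk, LinearMap.sub_apply, LinearMap.smul_apply]
    ring
  simp [christoffel, h]

/-! ### The first-order condition at a maximum -/

theorem grad_eq_zero_of_isLocalMax {u : M → ℝ} {p : M}
    (hu : MDifferentiableAt 𝓘(ℝ, E) 𝓘(ℝ) u p) (hmax : IsLocalMax u p) :
    grad 𝓘(ℝ, E) u p = 0 := by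
  have hf := isLocalMax_comp_extChartAt_symm (E := E) hmax
  refine ext_inner_right ℝ fun X ↦ ?_
  obtain ⟨e, rfl⟩ := exists_symmL_eq X
  rw [inner_grad, mvfderiv_symmL (mem_chart_source E p) hu, hf.fderiv_eq_zero]
  simp

/-! ### The Hessian of a function at a point -/

variable [IsContMDiffRiemannianBundle 𝓘(ℝ, E) ∞ E (fun x : M ↦ TangentSpace 𝓘(ℝ, E) x)]

theorem mdifferentiableAt_metricInChart (p : M) :
    MDifferentiableAt 𝓘(ℝ, E) 𝓘(ℝ, E →L[ℝ] E →L[ℝ] ℝ) (metricInChart 𝓘(ℝ, E) p) p := by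
  obtain ⟨g, hg, hgi⟩ := IsContMDiffRiemannianBundle.exists_contMDiff (IB := 𝓘(ℝ, E)) (n := ∞)
    (F := E) (E := fun x : M ↦ TangentSpace 𝓘(ℝ, E) x)
  have h := ((contMDiffAt_hom_bundle _).1 (hg.contMDiffAt (x := p))).2.mdifferentiableAt (by simp)
  refine h.congr_of_eventuallyEq ?_
  filter_upwards [(chartAt E p).open_source.mem_nhds (mem_chart_source E p)] with q hq
  ext v w
  rw [inCoordinates_apply_eq₂ (by simpa using hq) (by simpa using hq) (mem_univ _)]
  have hs := fun y ↦ Trivialization.symmL_apply (R := ℝ)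
    (trivializationAt E (TangentSpace 𝓘(ℝ, E)) p) (b := q) (by simpa using hq) y
  rw [metricInChart_apply, hgi]
  simp only [← hs]
  simp

/-- The gradient of a `C²` function is differentiable: in coordinates it is the inverse of the metric
applied to the differential. -/
theorem mdifferentiableAt_fieldInChart_grad {u : M → ℝ} {p : M}
    (hu : ContMDiffAt 𝓘(ℝ, E) 𝓘(ℝ) 2 u p) :
    MDifferentiableAt 𝓘(ℝ, E) 𝓘(ℝ, E) (fieldInChart 𝓘(ℝ, E) (grad 𝓘(ℝ, E) u) p) p := by
  have : IsManifold 𝓘(ℝ, E) 1 M := IsManifold.of_le (n := ∞) (by simp)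
  let α : M → E →L[ℝ] ℝ := fun q ↦
    fderiv ℝ (u ∘ (extChartAt 𝓘(ℝ, E) p).symm) (extChartAt 𝓘(ℝ, E) p q)
  have hα : MDifferentiableAt 𝓘(ℝ, E) 𝓘(ℝ, E →L[ℝ] ℝ) α p :=
    (((contDiffAt_comp_extChartAt_symm hu).fderiv_right (m := 1)
      (by norm_num)).differentiableAt (by simp)).mdifferentiableAt.comp p
      (mdifferentiableAt_extChartAt (mem_chart_source E p))
  have hinv : MDifferentiableAt 𝓘(ℝ, E) 𝓘(ℝ, (E →L[ℝ] ℝ) →L[ℝ] E)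
      (fun q ↦ (metricInChart 𝓘(ℝ, E) p q).inverse) p :=
    (((isInvertible_metricInChart (mem_chart_source E p)).contDiffAt_map_inverse
      (n := 1)).differentiableAt (by simp)).mdifferentiableAt.comp p
      (mdifferentiableAt_metricInChart p)
  refine (hinv.clm_apply hα).congr_of_eventuallyEq ?_
  filter_upwards [(chartAt E p).open_source.mem_nhds (mem_chart_source E p),
    eventually_mdifferentiableAt hu] with q hq huq
  rw [eq_comm, (isInvertible_metricInChart hq).inverse_apply_eq]
  exact (metricInChart_fieldInChart_grad hq huq).symm

/-- At a critical point the Hessian form is the second derivative of the chart representation: the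
Christoffel term vanishes, and differentiating `g_ij ∇ʲu = ∂_i u` leaves no derivative of the
metric. -/
theorem inner_hess_of_grad_eq_zero {u : M → ℝ} {p : M}
    (hu : ContMDiffAt 𝓘(ℝ, E) 𝓘(ℝ) 2 u p) (h0 : grad 𝓘(ℝ, E) u p = 0) (e : E) :
    inner ℝ (hess 𝓘(ℝ, E) u p ((trivializationAt E (TangentSpace 𝓘(ℝ, E)) p).symmL ℝ p e))
        ((trivializationAt E (TangentSpace 𝓘(ℝ, E)) p).symmL ℝ p e) =
      fderiv ℝ (fderiv ℝ (u ∘ (extChartAt 𝓘(ℝ, E) p).symm)) (extChartAt 𝓘(ℝ, E) p p) e e := by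
  set φ := extChartAt 𝓘(ℝ, E) p with hφ
  let V : M → E := fieldInChart 𝓘(ℝ, E) (grad 𝓘(ℝ, E) u) p
  have hp := mem_chart_source E p
  have hpφ : p ∈ φ.source := mem_extChartAt_source p
  have hinv : φ.symm (φ p) = p := φ.left_inv hpφ
  have hVd : MDifferentiableAt 𝓘(ℝ, E) 𝓘(ℝ, E) V p := mdifferentiableAt_fieldInChart_grad hu
  have hV0 : V p = 0 := by
    simp only [V]
    rw [fieldInChart_eq _ hp, h0, map_zero]
  have hg := hasFDerivAt_comp_extChartAt_symm (mdifferentiableAt_metricInChart (E := E) p)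
  have hV := hasFDerivAt_comp_extChartAt_symm hVd
  have hprod := hg.clm_apply hV
  have heq : (fun x ↦ (metricInChart 𝓘(ℝ, E) p ∘ φ.symm) x ((V ∘ φ.symm) x)) =ᶠ[𝓝 (φ p)]
      fderiv ℝ (u ∘ φ.symm) := by
    have hcont : Tendsto φ.symm (𝓝 (φ p)) (𝓝 p) := by
      have := (continuousAt_extChartAt_symm (I := 𝓘(ℝ, E)) p).tendsto
      rwa [← hφ, hinv] at this
    filter_upwards [hcont.eventually ((chartAt E p).open_source.mem_nhds hp),
      hcont.eventually (eventually_mdifferentiableAt hu),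
      (isOpen_extChartAt_target p).mem_nhds (mem_extChartAt_target p)] with x h1 h2 h3
    simp only [Function.comp_apply, V]
    rw [metricInChart_fieldInChart_grad h1 h2, φ.right_inv h3]
  -- The product rule has a second term, `Dg` applied to `V p`, which `hV0` removes at the end.
  rw [← heq.fderiv_eq, hprod.fderiv]
  have hc : christoffel 𝓘(ℝ, E) p
      ((trivializationAt E (TangentSpace 𝓘(ℝ, E)) p).symmL ℝ p e) 0 = 0 := by
    simpa using christoffel_sub_smul p
      ((trivializationAt E (TangentSpace 𝓘(ℝ, E)) p).symmL ℝ p e) 0 0 1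
  simp only [hess, covDeriv, LinearMap.coe_mk, AddHom.coe_mk, h0, hc, add_zero]
  rw [mvfderiv_symmL hp hVd]
  simp [hV0, metricInChart_apply]

theorem hess_sub_smul {u v : M → ℝ} {p : M} (hu : ContMDiffAt 𝓘(ℝ, E) 𝓘(ℝ) 2 u p)
    (hv : ContMDiffAt 𝓘(ℝ, E) 𝓘(ℝ) 2 v p) (a : ℝ) :
    hess 𝓘(ℝ, E) (u - a • v) p = hess 𝓘(ℝ, E) u p - a • hess 𝓘(ℝ, E) v p := by
  have hfield : fieldInChart 𝓘(ℝ, E) (grad 𝓘(ℝ, E) (u - a • v)) p =ᶠ[𝓝 p]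
      fieldInChart 𝓘(ℝ, E) (grad 𝓘(ℝ, E) u) p -
        a • fieldInChart 𝓘(ℝ, E) (grad 𝓘(ℝ, E) v) p := by
    filter_upwards [(chartAt E p).open_source.mem_nhds (mem_chart_source E p),
      eventually_mdifferentiableAt hu, eventually_mdifferentiableAt hv] with q hq h1 h2
    simp only [Pi.sub_apply, Pi.smul_apply]
    rw [fieldInChart_eq _ hq, fieldInChart_eq _ hq, fieldInChart_eq _ hq, grad_sub_smul h1 h2,
      map_sub, map_smul]
  ext X
  have h1 := mdifferentiableAt_fieldInChart_grad hu
  have h2 := mdifferentiableAt_fieldInChart_grad hv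
  simp only [hess, covDeriv, LinearMap.coe_mk, AddHom.coe_mk, LinearMap.sub_apply,
    LinearMap.smul_apply]
  rw [mvfderiv_congr hfield, mvfderiv_sub h1 (h2.const_smul a), mvfderiv_const_smul h2,
    grad_sub_smul (hu.mdifferentiableAt (by simp)) (hv.mdifferentiableAt (by simp)),
    christoffel_sub_smul]
  simp only [sub_apply, smul_apply, map_sub, map_smul, smul_add]
  abel

/-! ### The second-order condition at a maximum -/

theorem traceOp_nonpos_of_isLocalMax
    {P : Π p : M, TangentSpace 𝓘(ℝ, E) p →ₗ[ℝ] TangentSpace 𝓘(ℝ, E) p}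
    {u : M → ℝ} {p : M} (hP : (P p).IsPositive)
    (hu : ContMDiffAt 𝓘(ℝ, E) 𝓘(ℝ) 2 u p) (hmax : IsLocalMax u p) :
    traceOp 𝓘(ℝ, E) P u p ≤ 0 := by
  refine hP.trace_comp_nonpos fun X ↦ ?_
  obtain ⟨e, rfl⟩ := exists_symmL_eq X
  rw [inner_hess_of_grad_eq_zero hu
    (grad_eq_zero_of_isLocalMax (hu.mdifferentiableAt (by simp)) hmax)]
  exact (isLocalMax_comp_extChartAt_symm hmax).fderiv_fderiv_nonpos
    (contDiffAt_comp_extChartAt_symm hu) e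

/-- If `a • v` touches `u` from above at `p`, up to an additive constant, then the gradients agree at
`p` and the values of the operator are ordered. -/
theorem grad_eq_and_traceOp_le_of_isLocalMax_sub
    {P : Π p : M, TangentSpace 𝓘(ℝ, E) p →ₗ[ℝ] TangentSpace 𝓘(ℝ, E) p}
    {u v : M → ℝ} {p : M} {a : ℝ} (hP : (P p).IsPositive)
    (hu : ContMDiffAt 𝓘(ℝ, E) 𝓘(ℝ) 2 u p) (hv : ContMDiffAt 𝓘(ℝ, E) 𝓘(ℝ) 2 v p)
    (hmax : IsLocalMax (u - a • v) p) :
    grad 𝓘(ℝ, E) u p = a • grad 𝓘(ℝ, E) v p ∧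
      traceOp 𝓘(ℝ, E) P u p ≤ a * traceOp 𝓘(ℝ, E) P v p := by
  have hu' := hu.mdifferentiableAt (n := 2) (by simp)
  have hv' := hv.mdifferentiableAt (n := 2) (by simp)
  constructor
  · have := grad_eq_zero_of_isLocalMax (hu'.sub (hv'.const_smul a)) hmax
    rwa [grad_sub_smul hu' hv', sub_eq_zero] at this
  · have hav : ContMDiffAt 𝓘(ℝ, E) 𝓘(ℝ) 2 (a • v) p :=
      (contMDiffAt_const (I := 𝓘(ℝ, E)) (I' := 𝓘(ℝ)) (c := a)).smul hv
    have := traceOp_nonpos_of_isLocalMax hP (u := u - a • v) (hu.sub hav) hmax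
    rw [traceOp, hess_sub_smul hu hv, LinearMap.comp_sub, LinearMap.comp_smul, map_sub, map_smul,
      sub_nonpos] at this
    exact this

end TraceOperator

/-! ### Auxiliary facts about real functions -/

theorem monotoneOn_of_derivWithin_Ici_nonneg {G : ℝ → ℝ} (hG : ContDiffOn ℝ ∞ G (Ici 0))
    (hG_mono : ∀ t ∈ Ici (0 : ℝ), 0 ≤ derivWithin G (Ici 0) t) : MonotoneOn G (Ici 0) := by
  refine monotoneOn_of_deriv_nonneg (convex_Ici 0) hG.continuousOn ?_ ?_
  · exact (hG.differentiableOn (by simp)).mono interior_subset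
  · intro t ht
    rw [← derivWithin_of_mem_nhds (mem_interior_iff_mem_nhds.1 ht)]
    exact hG_mono t (interior_subset ht)

theorem exists_eventually_le_of_limsup_lt_top {g : ℝ → ℝ}
    (h : limsup (fun t ↦ (g t : EReal)) atTop < ⊤) :
    ∃ c : ℝ, 0 < c ∧ ∀ᶠ t in atTop, g t ≤ c := by
  obtain ⟨c, hc, -⟩ := EReal.lt_iff_exists_real_btwn.1 h
  refine ⟨max c 1, by positivity, ?_⟩
  filter_upwards [eventually_lt_of_limsup_lt hc] with t ht
  exact (EReal.coe_lt_coe_iff.1 ht).le.trans (le_max_left _ _)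

/-! ### Primitives of antitone functions -/

section Primitive

variable {f : ℝ → ℝ}

theorem AntitoneOn.intervalIntegrable_of_nonneg (hf : AntitoneOn f (Ici 0)) (a b : ℝ) (ha : 0 ≤ a)
    (hb : 0 ≤ b) : IntervalIntegrable f volume a b :=
  (hf.mono fun _ hx ↦ (le_min ha hb).trans hx.1).intervalIntegrable

theorem AntitoneOn.continuousOn_integral_Ici (hf : AntitoneOn f (Ici 0)) :
    ContinuousOn (fun t ↦ ∫ x in (0 : ℝ)..t, f x) (Ici 0) := by
  have hi := hf.intervalIntegrable_of_nonneg
  refine continuousOn_of_locally_continuousOn fun t ht ↦ ⟨Iio (t + 1), isOpen_Iio, by simp, ?_⟩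
  have ht1 : 0 ≤ t + 1 := by linarith [mem_Ici.1 ht]
  have h := intervalIntegral.continuousOn_primitive_interval (μ := volume) (f := f) (a := 0)
    (b := t + 1) (by
      rw [uIcc_of_le ht1, integrableOn_Icc_iff_integrableOn_Ioc]
      exact (intervalIntegrable_iff_integrableOn_Ioc_of_le ht1).1 (hi _ _ le_rfl ht1))
  exact h.mono fun x hx ↦ by rw [uIcc_of_le ht1]; exact ⟨hx.1, hx.2.le⟩

/-- A primitive of an antitone function is concave: its graph lies below the line of slope `f s`
through its point at `s`. -/
theorem AntitoneOn.integral_sub_integral_le (hf : AntitoneOn f (Ici 0)) {s t : ℝ} (hs : 0 ≤ s)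
    (ht : 0 ≤ t) : (∫ x in (0 : ℝ)..t, f x) - ∫ x in (0 : ℝ)..s, f x ≤ f s * (t - s) := by
  have hi := hf.intervalIntegrable_of_nonneg
  rw [intervalIntegral.integral_interval_sub_left (hi _ _ le_rfl ht) (hi _ _ le_rfl hs)]
  rcases le_total s t with hst | hts
  · have := intervalIntegral.integral_mono_on hst (hi s t hs ht)
      (intervalIntegrable_const (c := f s)) fun x hx ↦ hf hs (hs.trans hx.1) hx.1
    rw [intervalIntegral.integral_const, smul_eq_mul] at this
    linarith
  · have := intervalIntegral.integral_mono_on hts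
      (intervalIntegrable_const (c := f s)) (hi t s ht hs) fun x hx ↦ hf (ht.trans hx.1) hs hx.2
    rw [intervalIntegral.integral_const, smul_eq_mul] at this
    rw [intervalIntegral.integral_symm]
    linarith

theorem AntitoneOn.tendsto_integral_atTop (hf : AntitoneOn f (Ici 0)) (hf0 : ∀ t, 0 ≤ t → 0 ≤ f t)
    (hint : ¬ IntegrableOn f (Ioi 0)) : Tendsto (fun t ↦ ∫ x in (0 : ℝ)..t, f x) atTop atTop := by
  have hi := hf.intervalIntegrable_of_nonneg
  refine tendsto_atTop.2 fun c ↦ ?_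
  have hex : ∃ t, 0 ≤ t ∧ c ≤ ∫ x in (0 : ℝ)..t, f x := by
    by_contra! hc
    refine hint (integrableOn_Ioi_of_intervalIntegral_norm_bounded c 0 (l := atTop)
      (b := fun t : ℝ ↦ max t 0) (fun t ↦ ?_)
      (tendsto_atTop_mono (fun t ↦ le_max_left t 0) tendsto_id) (.of_forall fun t ↦ ?_))
    · exact (intervalIntegrable_iff_integrableOn_Ioc_of_le (le_max_right t 0)).1
        (hi _ _ le_rfl (le_max_right t 0))
    · refine le_trans (le_of_eq ?_) (hc _ (le_max_right t 0)).le
      refine intervalIntegral.integral_congr fun x hx ↦ ?_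
      rw [uIcc_of_le (le_max_right t 0)] at hx
      exact Real.norm_of_nonneg (hf0 x hx.1)
  obtain ⟨t₀, ht₀, hc⟩ := hex
  filter_upwards [eventually_ge_atTop t₀] with t ht
  have h1 := intervalIntegral.integral_interval_sub_left (hi 0 t le_rfl (ht₀.trans ht))
    (hi 0 t₀ le_rfl ht₀)
  have h2 : 0 ≤ ∫ x in t₀..t, f x :=
    intervalIntegral.integral_nonneg ht fun x hx ↦ hf0 x (ht₀.trans hx.1)
  linarith

end Primitive

/-! ### Almost maximal points by penalization -/

/-- Subtracting a small multiple of the exhaustion function `ψ` makes `u` attain a maximum, at a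
point where `u` exceeds any prescribed level below its supremum. -/
theorem exists_perturbed_max {X : Type*} [TopologicalSpace X] [Nonempty X] {u ψ : X → ℝ}
    (hu : Continuous u) (hub : BddAbove (range u)) (hψ : Continuous ψ) (hψ0 : ∀ x, 0 ≤ ψ x)
    (hψlim : Tendsto ψ (cocompact X) atTop) {r : ℝ} (hr : r < ⨆ x, u x)
    {δ : ℝ} (hδ : 0 < δ) :
    ∃ ε, 0 < ε ∧ ε ≤ δ ∧ ∃ p, r < u p ∧ ∀ q, u q - ε * ψ q ≤ u p - ε * ψ p := by
  obtain ⟨q, hq⟩ := exists_lt_of_lt_ciSup hr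
  have hpos : 0 < u q - r := by linarith
  have hψq : 0 < 1 + ψ q := by linarith [hψ0 q]
  -- With this choice `u - ε ψ` exceeds `r` at `q`, hence at its maximum, and `ψ ≥ 0`.
  let ε := min δ ((u q - r) / (1 + ψ q))
  have hε : 0 < ε := lt_min hδ (by positivity)
  have hεψ : ε * ψ q < u q - r := by
    have h1 : ε * (1 + ψ q) ≤ u q - r := (le_div_iff₀ hψq).1 (min_le_right _ _)
    linarith
  obtain ⟨b, hb⟩ := hub
  have hlim : Tendsto (fun x ↦ u x - ε * ψ x) (cocompact X) atBot := by
    refine tendsto_atBot_mono (f := fun x ↦ b + -(ε * ψ x)) (fun x ↦ ?_) ?_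
    · linarith [hb (mem_range_self x)]
    · exact tendsto_atBot_add_const_left _ _
        (tendsto_neg_atTop_atBot.comp (hψlim.const_mul_atTop hε))
  obtain ⟨p, hp⟩ := (hu.sub (hψ.const_mul ε)).exists_forall_ge hlim
  refine ⟨ε, hε, min_le_left _ _, p, ?_, hp⟩
  have h1 : u q - ε * ψ q ≤ u p - ε * ψ p := hp q
  have h2 := mul_nonneg hε.le (hψ0 p)
  linarith

/-! ### The maximum principle at infinity -/

theorem theorem3p1 {n : ℕ} {M : Type*} [TopologicalSpace M] [T2Space M] [Nonempty M]
    [ChartedSpace (EuclideanSpace ℝ (Fin n)) M] [IsManifold (𝓡 n) ∞ M]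
    [RiemannianBundle (fun x : M ↦ TangentSpace (𝓡 n) x)]
    [IsContMDiffRiemannianBundle (𝓡 n) ∞ (EuclideanSpace ℝ (Fin n))
      (fun x : M ↦ TangentSpace (𝓡 n) x)]
    (P : Π p : M, TangentSpace (𝓡 n) p →ₗ[ℝ] TangentSpace (𝓡 n) p)
    (hP : ∀ p, (P p).IsPositive)
    (hPtr : BddAbove (range fun p ↦ LinearMap.trace ℝ (TangentSpace (𝓡 n) p) (P p)))
    (G : ℝ → ℝ) (hG : ContDiffOn ℝ ∞ G (Ici 0))
    (hG_pos : 0 < G 0)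
    (hG_mono : ∀ t ∈ Ici (0 : ℝ), 0 ≤ derivWithin G (Ici 0) t)
    (hG_int : ¬ IntegrableOn (fun t ↦ 1 / √(G t)) (Ioi 0))
    (hG_lim : limsup (fun t : ℝ ↦ ((t * G (√t) / G t : ℝ) : EReal)) atTop < ⊤)
    (γ : M → ℝ) (hγ : ContMDiff (𝓡 n) 𝓘(ℝ) 2 γ) (hγ_nonneg : ∀ p, 0 ≤ γ p)
    (hγ_lim : Tendsto γ (cocompact M) atTop)
    (hγ_grad : ∃ A : ℝ, 0 < A ∧ ∃ K : Set M, IsCompact K ∧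
      ∀ p ∉ K, ‖TraceOperator.grad (𝓡 n) γ p‖ ≤ A * √(γ p))
    (hγ_L : ∃ B : ℝ, 0 < B ∧ ∃ K : Set M, IsCompact K ∧
      ∀ p ∉ K, TraceOperator.traceOp (𝓡 n) P γ p ≤ B * √(γ p) * √(G (√(γ p)))) :
    ∀ u : M → ℝ, ContMDiff (𝓡 n) 𝓘(ℝ) 2 u → BddAbove (range u) →
      ∃ p : ℕ → M, ∀ j : ℕ, 1 ≤ j →
        (⨆ x, u x) - 1 / (j : ℝ) < u (p j) ∧
        ‖TraceOperator.grad (𝓡 n) u (p j)‖ < 1 / (j : ℝ) ∧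
        TraceOperator.traceOp (𝓡 n) P u (p j) < 1 / (j : ℝ) := by
  intro u hu hub
  have hG_monoOn := monotoneOn_of_derivWithin_Ici_nonneg hG hG_mono
  have hGpos : ∀ t, 0 ≤ t → 0 < G t := fun t ht ↦
    hG_pos.trans_le (hG_monoOn self_mem_Ici ht ht)
  let f : ℝ → ℝ := fun t ↦ 1 / √(G t)
  have hf0 : ∀ t, 0 ≤ t → 0 ≤ f t := fun t _ ↦ by positivity
  have hf : AntitoneOn f (Ici 0) := fun s hs t ht hst ↦
    one_div_le_one_div_of_le (Real.sqrt_pos.2 (hGpos s hs))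
      (Real.sqrt_le_sqrt (hG_monoOn hs ht hst))
  let ψ : M → ℝ := fun p ↦ ∫ x in (0 : ℝ)..γ p, f x
  have hψ0 : ∀ p, 0 ≤ ψ p := fun p ↦
    intervalIntegral.integral_nonneg (hγ_nonneg p) fun x hx ↦ hf0 x hx.1
  have hψlim : Tendsto ψ (cocompact M) atTop :=
    (hf.tendsto_integral_atTop hf0 hG_int).comp hγ_lim
  have hψc : Continuous ψ := by
    have h := hf.continuousOn_integral_Ici
    exact h.comp_continuous hγ.continuous hγ_nonneg
  obtain ⟨c, hc0, hc⟩ := exists_eventually_le_of_limsup_lt_top hG_lim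
  obtain ⟨A, hA, K₁, hK₁, hgrad⟩ := hγ_grad
  obtain ⟨B, hB, K₂, hK₂, hL⟩ := hγ_L
  have hfar : ∀ᶠ p in cocompact M, p ∉ K₁ ∧ p ∉ K₂ ∧ 0 < γ p ∧
      γ p * G (√(γ p)) / G (γ p) ≤ c := by
    filter_upwards [hK₁.compl_mem_cocompact, hK₂.compl_mem_cocompact,
      hγ_lim.eventually_gt_atTop 0, hγ_lim.eventually hc] with p h1 h2 h3 h4
    exact ⟨h1, h2, h3, h4⟩
  obtain ⟨K, hK, hKfar⟩ := mem_cocompact.1 hfar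
  -- On the complement of `K`, the function `ψ` has gradient bounded by `C` and `L ψ ≤ C`; these are
  -- stated for `f (γ p) • ∇γ` and `f (γ p) * L γ`, which avoids differentiating `ψ` twice.
  let C := max (A * √(c / G 0)) (B * √c)
  have hC : 0 < C := lt_max_of_lt_right (by positivity)
  have hgradC : ∀ p ∉ K, f (γ p) * ‖TraceOperator.grad (𝓡 n) γ p‖ ≤ C := by
    intro p hp
    obtain ⟨h1, -, h3, h4⟩ := hKfar hp
    have hG1 := hGpos _ h3.le
    have hG2 : G 0 ≤ G (√(γ p)) := hG_monoOn self_mem_Ici (Real.sqrt_nonneg _) (Real.sqrt_nonneg _)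
    have hle : γ p / G (γ p) ≤ c / G 0 := by
      rw [div_le_iff₀ hG1] at h4
      rw [div_le_div_iff₀ hG1 hG_pos]
      exact (mul_le_mul_of_nonneg_left hG2 h3.le).trans h4
    calc f (γ p) * ‖TraceOperator.grad (𝓡 n) γ p‖
        ≤ f (γ p) * (A * √(γ p)) := mul_le_mul_of_nonneg_left (hgrad p h1) (hf0 _ h3.le)
      _ = A * √(γ p / G (γ p)) := by rw [Real.sqrt_div h3.le]; simp only [f]; ring
      _ ≤ A * √(c / G 0) := by gcongr
      _ ≤ C := le_max_left _ _
  have hLC : ∀ p ∉ K, f (γ p) * TraceOperator.traceOp (𝓡 n) P γ p ≤ C := by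
    intro p hp
    obtain ⟨-, h2, h3, h4⟩ := hKfar hp
    calc f (γ p) * TraceOperator.traceOp (𝓡 n) P γ p
        ≤ f (γ p) * (B * √(γ p) * √(G (√(γ p)))) :=
          mul_le_mul_of_nonneg_left (hL p h2) (hf0 _ h3.le)
      _ = B * √(γ p * G (√(γ p)) / G (γ p)) := by
          rw [Real.sqrt_div (mul_nonneg h3.le (hGpos _ (Real.sqrt_nonneg _)).le),
            Real.sqrt_mul h3.le]
          simp only [f]; ring
      _ ≤ B * √c := by gcongr
      _ ≤ C := le_max_right _ _
  have key : ∀ η : ℝ, 0 < η → ∃ p, (⨆ x, u x) - η < u p ∧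
      ‖TraceOperator.grad (𝓡 n) u p‖ < η ∧ TraceOperator.traceOp (𝓡 n) P u p < η := by
    intro η hη
    by_cases hatt : ∃ p, ∀ q, u q ≤ u p
    · obtain ⟨p, hp⟩ := hatt
      have hmax : IsLocalMax u p := .of_forall hp
      refine ⟨p, by linarith [ciSup_le hp], ?_, ?_⟩
      · rwa [TraceOperator.grad_eq_zero_of_isLocalMax (hu.mdifferentiable (by simp) p) hmax,
          norm_zero]
      · exact (TraceOperator.traceOp_nonpos_of_isLocalMax (hP p) (hu p) hmax).trans_lt hη
    -- The supremum is not attained, so it exceeds the maximum of `u` on `K`, and a level `r` between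
    -- them keeps the almost maximal points out of `K`.
    push Not at hatt
    have hr : ∃ r, (⨆ x, u x) - η ≤ r ∧ r < (⨆ x, u x) ∧ ∀ p ∈ K, u p ≤ r := by
      rcases K.eq_empty_or_nonempty with rfl | hne
      · exact ⟨_, le_rfl, by linarith, by simp⟩
      · obtain ⟨k, -, hk⟩ := hK.exists_isMaxOn hne hu.continuous.continuousOn
        obtain ⟨q, hq⟩ := hatt k
        exact ⟨max ((⨆ x, u x) - η) (u k), le_max_left _ _,
          max_lt (by linarith) (hq.trans_le (le_ciSup hub q)),
          fun p hp ↦ (hk hp).trans (le_max_right _ _)⟩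
    obtain ⟨r, hr1, hr2, hr3⟩ := hr
    obtain ⟨ε, hε, hεη, p, hp, hpmax⟩ := exists_perturbed_max hu.continuous hub hψc hψ0 hψlim hr2
      (show 0 < η / (2 * C) by positivity)
    have hpK : p ∉ K := fun h ↦ (hr3 p h).not_gt hp
    have hεC : ε * C < η := by
      have := (le_div_iff₀ (by positivity)).1 hεη
      linarith
    -- By concavity, `ψ` may be replaced in the maximality of `u - ε ψ` by its first-order expansion
    -- in `γ` at `p`.
    have hmax : IsLocalMax (u - (ε * f (γ p)) • γ) p := .of_forall fun q ↦ by
      have h1 := hpmax q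
      have h2 := mul_le_mul_of_nonneg_left
        (hf.integral_sub_integral_le (hγ_nonneg p) (hγ_nonneg q)) hε.le
      simp only [Pi.sub_apply, Pi.smul_apply, smul_eq_mul]
      simp only [ψ] at h1
      linarith
    obtain ⟨h1, h2⟩ :=
      TraceOperator.grad_eq_and_traceOp_le_of_isLocalMax_sub (hP p) (hu p) (hγ p) hmax
    refine ⟨p, hr1.trans_lt hp, ?_, ?_⟩
    · rw [h1, norm_smul, Real.norm_of_nonneg (mul_nonneg hε.le (hf0 _ (hγ_nonneg p))), mul_assoc]
      exact (mul_le_mul_of_nonneg_left (hgradC p hpK) hε.le).trans_lt hεC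
    · rw [mul_assoc] at h2
      exact (h2.trans (mul_le_mul_of_nonneg_left (hLC p hpK) hε.le)).trans_lt hεC
  have hseq : ∀ j : ℕ, ∃ p, 1 ≤ j → (⨆ x, u x) - 1 / (j : ℝ) < u p ∧
      ‖TraceOperator.grad (𝓡 n) u p‖ < 1 / (j : ℝ) ∧
      TraceOperator.traceOp (𝓡 n) P u p < 1 / (j : ℝ) := fun j ↦ by
    rcases Nat.eq_zero_or_pos j with rfl | hj
    -- The condition is vacuous at `j = 0`.
    · exact ⟨Classical.arbitrary M, by simp⟩
    · obtain ⟨p, hp⟩ := key (1 / j) (by positivity)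
      exact ⟨p, fun _ ↦ hp⟩
  choose p hp using hseq
  exact ⟨p, hp⟩
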